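/- **Definitions.** A mixed graph is a finite vertex set $V$ with a set of ordered pairs of distinct vertices, called arcs. Write $x\leftrightarrow y$ if both $(x,y)$ and $(y,x)$ are arcs (a digon), and $x\to y$ if $(x,y)$ is an arc but $(y,x)$ is not. The mixed graph is oriented if it has no digons; its underlying graph joins $x$ and $y$ whenever $(x,y)$ or $(y,x)$ is an arc; it is bipartite if its underlying graph is. For a real $\theta$, the matrix $H_\theta(G)\in\mathbb C^{V\times V}$ has $(x,y)$-entry $1$ if $x\leftrightarrow y$, $e^{i\theta}$ if $x\to y$, $e^{-i\theta}$ if $y\to x$, and $0$ otherwise. $G$ has the $\theta$-symmetric spectrum if the multiset of eigenvalues of $H_\theta(G)$ is invariant under $\lambda\mapsto-\lambda$. An angle $\theta\in(0,\pi]$ has the bipartite detection property if, for every mixed graph $G$, $G$ is bipartite if and only if $G$ has the $\theta$-symmetric spectrum. The flux of a closed path is the sum over its steps $u,v$ of $\theta$ if $u\to v$, $-\theta$ if $v\to u$, and $0$ if $u\leftrightarrow v$. For $m\ge 2$ and $0\le a\le m-1$ let $P_m^{(a,m-1-a)}$ be the oriented path on $p_1,\dots,p_m$ with arcs $(p_k,p_{k+1})$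 for $1\le k\le a$ and $(p_{k+1},p_k)$ for $a<k\le m-1$. For $m\ge2$ the oriented book graph $G_m$ consists of two vertices $x,y$ with the arc $(x,y)$ and, for each $j=1,\dots,m$, a vertex $z_j$, a copy of $P_m^{(0,m-1)}$ with $p_1=x$, $p_m=z_j$, and a copy of $P_m^{(j-1,m-j)}$ with $p_1=y$, $p_m=z_j$, all these paths being otherwise disjoint. **Theorem.** 1. No angle $\theta\in\mathbb Q\pi\cap(0,\pi]$ has the bipartite detection property. 2. The mixed graph on four vertices $0,1,2,3$ with $0\to1$, $1\leftrightarrow2$, $2\leftrightarrow3$, $3\leftrightarrow0$, $0\leftrightarrow2$ and no other arcs is not bipartite, but has the $\pi$-symmetric spectrum. 3. Let $\theta=\frac lm\pi$ with positive integers $l<m$ (not necessarily coprime). Then $G_m$ is an oriented graph whose underlying graph is the union of $m$ copies $C_1,\dots,C_m$ of the cycle $C_{2m-1}$ that all contain the edge $xy$ and pairwise share no vertices but $x,y$; here $C_j$ passes through the two paths joining $x$ and $y$ to $z_j$, and its flux, in the direction in which the edge $xy$ is traversed from $x$ to $y$, is $(2j-1)\theta$. The graph $G_m$ is not bipartite,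 yet, writing $n$ for its number of vertices and $\det(tI_n-H_\theta(G_m))=\sum_{k=0}^n a_kt^{n-k}$, one has $a_k=0$ for every odd $k\le n$; moreover $G_m$ has the $\theta$-symmetric spectrum. -/

import Mathlib

/-- A mixed graph on `V`: a set of arcs (ordered pairs) avoiding the diagonal. -/
structure MixedGraph (V : Type*) where
  Arc : V → V → Prop
  irrefl : ∀ x, ¬ Arc x x

namespace MixedGraph

/-- The underlying graph `Γ(G)`: `x` and `y` are adjacent if there is an arc between them,
in at least one direction. -/
def underlying {V : Type*} (G : MixedGraph V) : SimpleGraph V where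
  Adj x y := G.Arc x y ∨ G.Arc y x
  symm := ⟨fun _ _ h => h.symm⟩
  loopless := ⟨fun x h => h.elim (G.irrefl x) (G.irrefl x)⟩

/-- A mixed graph is oriented if it has no digons. -/
def IsOriented {V : Type*} (G : MixedGraph V) : Prop :=
  ∀ x y, G.Arc x y → ¬ G.Arc y x

/-- A mixed graph is bipartite if its underlying graph is. -/
def IsBipartite {V : Type*} (G : MixedGraph V) : Prop :=
  G.underlying.IsBipartite

open Classical in
/-- The `θ`-Hermitian adjacency matrix. -/
noncomputable def hermAdj {V : Type*} (G : MixedGraph V) (θ : ℝ) : Matrix V V ℂ :=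
  Matrix.of fun x y =>
    if G.Arc x y ∧ G.Arc y x then 1
    else if G.Arc x y then Complex.exp (Complex.I * θ)
    else if G.Arc y x then Complex.exp (-(Complex.I * θ))
    else 0

/-- The multiset of eigenvalues of the `θ`-Hermitian adjacency matrix. -/
noncomputable def spec {V : Type*} [Fintype V] [DecidableEq V]
    (G : MixedGraph V) (θ : ℝ) : Multiset ℂ :=
  (G.hermAdj θ).charpoly.roots

/-- The spectrum is symmetric with respect to the origin, including multiplicities. -/
def HasSymmetricSpectrum {V : Type*} [Fintype V] [DecidableEq V]
    (G : MixedGraph V) (θ : ℝ) : Prop :=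
  (G.spec θ).map (fun z => -z) = G.spec θ

open Classical in
/-- The 1-form of a mixed graph: `θ` along an arc, `-θ` against an arc, `0` on a digon. -/
noncomputable def form {V : Type*} (G : MixedGraph V) (θ : ℝ) (x y : V) : ℝ :=
  if G.Arc x y ∧ G.Arc y x then 0
  else if G.Arc x y then θ
  else if G.Arc y x then -θ
  else 0

/-- The magnetic flux through the closed path `c 0, c 1, …, c (n - 1), c 0`. -/
noncomputable def flux {V : Type*} (G : MixedGraph V) (θ : ℝ) {n : ℕ} (c : Fin n → V) : ℝ :=
  ∑ k, G.form θ (c k) (c (finRotate n k))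

end MixedGraph

/-- The angle `θ` has the bipartite detection property: for every finite mixed graph,
being bipartite is equivalent to having the `θ`-symmetric spectrum. -/
def BipartiteDetectionProperty (θ : ℝ) : Prop :=
  ∀ (V : Type) [Fintype V] [DecidableEq V] (G : MixedGraph V),
    G.IsBipartite ↔ G.HasSymmetricSpectrum θ

/-- The 4-vertex mixed graph with the arc `0 → 1` and the digons
`{1, 2}`, `{2, 3}`, `{3, 0}`, `{0, 2}`. -/
def fourVertexGraph : MixedGraph (Fin 4) where
  Arc u v := (u, v) = (0, 1) ∨
    s(u, v) = s(1, 2) ∨ s(u, v) = s(2, 3) ∨ s(u, v) = s(3, 0) ∨ s(u, v) = s(0, 2)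
  irrefl := by decide

/-- The oriented path `P_m^{(a, m-1-a)}` on `p_1, …, p_m` (here the vertex `s` stands for
`p_{s+1}`): the first `a` edges point forward, the other `m - 1 - a` edges point backward. -/
def orientedPath (m a : ℕ) : MixedGraph (Fin m) where
  Arc s t := (s.val + 1 = t.val ∧ s.val < a) ∨ (t.val + 1 = s.val ∧ a ≤ t.val)
  irrefl := by intro s h; omega

/-- The vertices of the book graph with `m` pages (`m ≥ 2`): the two vertices `x`, `y`, and
the `2 m - 3` further vertices of each page, listed along the page from `y` to `x`. -/
abbrev BookVertex (m : ℕ) : Type := Fin 2 ⊕ (Fin m × Fin (2 * m - 3))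

def bookX (m : ℕ) : BookVertex m := Sum.inl 0

def bookY (m : ℕ) : BookVertex m := Sum.inl 1

/-- The path `p_1, …, p_m` from `p_1 = x` to the middle vertex `p_m = z_j` of the page `j`. -/
def bookXPath (m : ℕ) (j s : Fin m) : BookVertex m :=
  if h : s.val = 0 then bookX m
  else Sum.inr (j, ⟨2 * m - 3 - s.val, by omega⟩)

/-- The path `p_1, …, p_m` from `p_1 = y` to the middle vertex `p_m = z_j` of the page `j`. -/
def bookYPath (m : ℕ) (j s : Fin m) : BookVertex m :=
  if h : s.val = 0 then bookY m
  else Sum.inr (j, ⟨s.val - 1, by omega⟩)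

theorem bookXPath_injective (m : ℕ) (j : Fin m) : Function.Injective (bookXPath m j) := by
  intro s t h
  unfold bookXPath bookX at h
  split_ifs at h <;> simp at h <;> omega

theorem bookYPath_injective (m : ℕ) (j : Fin m) : Function.Injective (bookYPath m j) := by
  intro s t h
  unfold bookYPath bookY at h
  split_ifs at h <;> simp at h <;> omega

/-- The oriented book graph `G_m`: the arc `x → y`, and for each `j = 1, …, m` a path
`P_m^{(0, m-1)}` from `x` to `z_j` and a path `P_m^{(j-1, m-j)}` from `y` to `z_j`
(the index `j` is shifted to start at `0`). -/
def bookGraph (m : ℕ) : MixedGraph (BookVertex m) where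
  Arc u v :=
    (u = bookX m ∧ v = bookY m) ∨
    (∃ j s t, (orientedPath m 0).Arc s t ∧ u = bookXPath m j s ∧ v = bookXPath m j t) ∨
    (∃ j s t, (orientedPath m j.val).Arc s t ∧ u = bookYPath m j s ∧ v = bookYPath m j t)
  irrefl := by
    rintro u (⟨h, h'⟩ | ⟨j, s, t, ha, h, h'⟩ | ⟨j, s, t, ha, h, h'⟩)
    · simp [h, bookX, bookY] at h'
    · obtain rfl := bookXPath_injective m j (h.symm.trans h')
      exact (orientedPath m 0).irrefl s ha
    · obtain rfl := bookYPath_injective m j (h.symm.trans h')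
      exact (orientedPath m j.val).irrefl s ha

/-- The copies `C j` of the cycle `C_n` in `Γ` all start with the edge from `x` to `y`, have
pairwise nothing but the vertices `x`, `y` in common, and together make up all of `Γ`. -/
def IsBook {V : Type*} (Γ : SimpleGraph V) (x y : V) {m n : ℕ}
    (C : Fin m → (SimpleGraph.cycleGraph n).Copy Γ) : Prop :=
  (∀ j (k : Fin n), (k.val = 0 → C j k = x) ∧ (k.val = 1 → C j k = y)) ∧
  (∀ i j, i ≠ j → Set.range (C i) ∩ Set.range (C j) = {x, y}) ∧
  (∀ v, ∃ j, v ∈ Set.range (C j)) ∧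
  (∀ u v, Γ.Adj u v → ∃ j a b,
    (SimpleGraph.cycleGraph n).Adj a b ∧ C j a = u ∧ C j b = v)

/-!
For `θ = l π / m` the odd cycles of the book graph `G_m` are exactly its pages, closed up by the edge
`xy`, and their fluxes are `(2 j + 1) θ` for `0 ≤ j < m`. In the expansion of the characteristic
polynomial every term of the wrong parity uses exactly one of these cycles, and these terms add up to
a multiple of `∑ j, 2 cos ((2 j + 1) θ) = 0`. The proof replaces this expansion by linear algebra.

Write `z = exp (i θ)`. A diagonal gauge transformation moves all phases to the edges between `x` and
the pages (`charpoly_hermAdj_bookGraph`), where they become the total fluxes `z ^ (2 j + 1)`; all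
pages then carry the same path matrix. Eliminating the pages by a Schur complement leaves a `2 × 2`
determinant, and the correction to its off-diagonal entries is proportional to
`∑ j, z ^ (2 j + 1)` or its conjugate, which vanish as `z ^ 2 ≠ 1` is an `m`-th root of unity. Hence
the sign of the entry for the edge `xy` is irrelevant to the characteristic polynomial
(`charpoly_bookMatrix_neg`). As `G_m` without the edge `xy` is bipartite, this sign change has the
same effect as negating the whole matrix (`charpoly_neg_bookMatrix`). So `H` and `-H` have the same
characteristic polynomial, which is equivalent to the vanishing of the coefficients of the wrong
parity and implies that the spectrum is symmetric.

The matrix of the four-vertex graph is taken to its negative by a signed permutation. Rational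
multiples of `π` below `π` are thus excluded by the book graphs, and `π` itself by the four-vertex
graph.
-/

open scoped Kronecker Matrix

/-! ### Characteristic polynomials -/

/-- Matrices that are intertwined by an invertible matrix have the same characteristic
polynomial. -/
theorem charpoly_eq_of_intertwine {n R : Type*} [Fintype n] [DecidableEq n] [CommRing R]
    {P M N : Matrix n n R} (hP : IsUnit P) (h : P * M = N * P) : M.charpoly = N.charpoly := by
  obtain ⟨U, rfl⟩ := hP
  rw [← Matrix.charpoly_units_conj U M, h, mul_assoc, ← Matrix.coe_units_inv, Units.mul_inv,
    mul_one]

/-- The special case of an invertible diagonal matrix. -/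
theorem charpoly_eq_of_gauge {n K : Type*} [Fintype n] [DecidableEq n] [Field K]
    {M N : Matrix n n K} {u : n → K} (hu : ∀ a, u a ≠ 0)
    (h : ∀ a b, u a * M a b = N a b * u b) : M.charpoly = N.charpoly := by
  refine charpoly_eq_of_intertwine (P := Matrix.diagonal u) ?_ ?_
  · rw [Matrix.isUnit_iff_isUnit_det, Matrix.det_diagonal, isUnit_iff_ne_zero]
    exact Finset.prod_ne_zero_iff.2 fun a _ => hu a
  · ext a b
    simpa using h a b

theorem charpoly_neg {n K : Type*} [Fintype n] [DecidableEq n] [Field K] [Infinite K]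
    (M : Matrix n n K) :
    (-M).charpoly = Polynomial.C ((-1) ^ Fintype.card n) * M.charpoly.comp (-Polynomial.X) := by
  refine Polynomial.funext fun t => ?_
  rw [Polynomial.eval_mul, Polynomial.eval_C, Polynomial.eval_comp, Polynomial.eval_neg,
    Polynomial.eval_X, Matrix.eval_charpoly, Matrix.eval_charpoly, ← Matrix.det_neg]
  congr 1
  simp [map_neg, sub_eq_add_neg, add_comm]

theorem charpoly_coeff_eq_zero_of_neg {n K : Type*} [Fintype n] [DecidableEq n] [Field K]
    [CharZero K] {M : Matrix n n K} (h : (-M).charpoly = M.charpoly)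
    {k : ℕ} (hk : Odd k) (hkn : k ≤ Fintype.card n) :
    M.charpoly.coeff (Fintype.card n - k) = 0 := by
  have e := congrArg (fun p => p.coeff (Fintype.card n - k)) (charpoly_neg M)
  rw [show (-Polynomial.X : Polynomial K) = Polynomial.C (-1) * Polynomial.X by simp] at e
  simp only [h, Polynomial.comp_C_mul_X_coeff, Polynomial.coeff_C_mul] at e
  obtain ⟨d, hd⟩ := Nat.exists_eq_add_of_le hkn
  rw [hd, Nat.add_sub_cancel_left, pow_add, hk.neg_one_pow] at e
  rw [hd, Nat.add_sub_cancel_left]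
  have h1 : (-1 : K) ^ d * (-1) ^ d = 1 := by rw [← mul_pow]; simp
  have h2 : 2 * M.charpoly.coeff d = 0 := by
    linear_combination e - M.charpoly.coeff d * h1
  simpa using h2

namespace MixedGraph

theorem hasSymmetricSpectrum_of_charpoly_neg {V : Type*} [Fintype V] [DecidableEq V]
    {G : MixedGraph V} {θ : ℝ} (h : (-G.hermAdj θ).charpoly = (G.hermAdj θ).charpoly) :
    G.HasSymmetricSpectrum θ := by
  unfold HasSymmetricSpectrum spec
  have h1 := congrArg Polynomial.roots (charpoly_neg (G.hermAdj θ))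
  rw [h, Polynomial.roots_C_mul _ (pow_ne_zero _ (by norm_num))] at h1
  rw [← Polynomial.roots_comp_neg_X, ← h1]

end MixedGraph

/-! ### The gauged adjacency matrix of a book -/

/-- The adjacency matrix of the path on `n` vertices. -/
def pathMatrix (n : ℕ) : Matrix (Fin n) (Fin n) ℂ :=
  Matrix.of fun i i' => if i.val + 1 = i'.val ∨ i'.val + 1 = i.val then 1 else 0

/-- The indicator functions of the ends of a path on `n` vertices, listed from `y` to `x`: the last
vertex, which is joined to `x`, and the first one, which is joined to `y`. -/
def pathEnd (n : ℕ) : Fin 2 → Fin n → ℂ :=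
  ![fun i => if i.val + 1 = n then 1 else 0, fun i => if i.val = 0 then 1 else 0]

/-- The entries between the two vertices `x`, `y` and the pages of a book: `x` is joined to the last
vertex of the page `j` with weight `a j`, and `y` to the first vertex with weight `1`. -/
def bookRows (m : ℕ) (a : Fin m → ℂ) : Matrix (Fin 2) (Fin m × Fin (2 * m - 3)) ℂ :=
  Matrix.of fun r p => ![a, 1] r p.1 * pathEnd (2 * m - 3) r p.2

/-- The Hermitian adjacency matrix of a book with `m` pages in the gauge where all phases
sit on the edges between `x` and the pages: the entry for `xy` is `w`, and the edge between `x` and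
the last vertex of the page `j` has the entries `a j` and `b j` in its two directions. -/
noncomputable def bookMatrix (m : ℕ) (a b : Fin m → ℂ) (w : ℂ) :
    Matrix (BookVertex m) (BookVertex m) ℂ :=
  Matrix.fromBlocks !![0, w; w, 0] (bookRows m a) (bookRows m b)ᵀ
    ((1 : Matrix (Fin m) (Fin m) ℂ) ⊗ₖ pathMatrix (2 * m - 3))

/-- If the entries of the outer factors are products of a block part and a part within the block,
their product around a matrix with equal diagonal blocks factors accordingly. -/
theorem mul_one_kronecker_mul_apply {α β ι κ R : Type*} [Fintype ι] [Fintype κ] [DecidableEq ι]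
    [CommSemiring R] (c : α → ι → R) (e : α → κ → R) (d : β → ι → R) (f : β → κ → R)
    (N : Matrix κ κ R) (r : α) (s : β) :
    ((Matrix.of fun r (p : ι × κ) => c r p.1 * e r p.2) * ((1 : Matrix ι ι R) ⊗ₖ N) *
      (Matrix.of fun s (p : ι × κ) => d s p.1 * f s p.2)ᵀ) r s =
      (∑ j, c r j * d s j) * ∑ i', ∑ i, e r i * N i i' * f s i' := by
  simp only [Matrix.mul_apply, Fintype.sum_prod_type, Matrix.kronecker_apply, Matrix.one_apply,
    Matrix.of_apply, Matrix.transpose_apply, Finset.sum_mul]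
  refine Finset.sum_congr rfl fun j _ => ?_
  rw [Finset.mul_sum]
  refine Finset.sum_congr rfl fun i' _ => ?_
  rw [Finset.sum_eq_single j (fun j' _ h => by simp [h]) (by simp), Finset.mul_sum]
  refine Finset.sum_congr rfl fun i _ => ?_
  simp
  ring

/-- If the phases of the pages sum to zero, eliminating the pages by a Schur complement leaves no
correction to the entries at `(x, y)` and `(y, x)`. Hence the characteristic polynomial depends on
the entry `w` only through `w ^ 2`. -/
theorem charpoly_bookMatrix_neg {m : ℕ} {a b : Fin m → ℂ} (ha : ∑ j, a j = 0)
    (hb : ∑ j, b j = 0) (w : ℂ) :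
    (bookMatrix m a b (-w)).charpoly = (bookMatrix m a b w).charpoly := by
  -- It suffices to compare values outside the spectrum of the page, where the page is invertible.
  refine Polynomial.eq_of_infinite_eval_eq _ _ (Set.Infinite.mono (s :=
    {t | (pathMatrix (2 * m - 3)).charpoly.IsRoot t}ᶜ) ?_ ?_)
  · intro t ht
    have hN : IsUnit (Matrix.scalar (Fin (2 * m - 3)) t - pathMatrix (2 * m - 3)).det := by
      rw [← Matrix.eval_charpoly]
      exact isUnit_iff_ne_zero.2 ht
    set Q := Matrix.scalar (Fin (2 * m - 3)) t - pathMatrix (2 * m - 3) with hQ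
    have hD : (1 : Matrix (Fin m) (Fin m) ℂ) ⊗ₖ Q * (1 : Matrix (Fin m) (Fin m) ℂ) ⊗ₖ Q⁻¹ = 1 := by
      rw [← Matrix.mul_kronecker_mul, Matrix.mul_nonsing_inv _ hN, mul_one,
        Matrix.one_kronecker_one]
    let _ : Invertible ((1 : Matrix (Fin m) (Fin m) ℂ) ⊗ₖ Q) := invertibleOfRightInverse _ _ hD
    set S := bookRows m a * ((1 : Matrix (Fin m) (Fin m) ℂ) ⊗ₖ Q⁻¹) * (bookRows m b)ᵀ with hS
    have hdet : ∀ v, (bookMatrix m a b v).charpoly.eval t =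
        ((1 : Matrix (Fin m) (Fin m) ℂ) ⊗ₖ Q).det *
          (Matrix.scalar (Fin 2) t - !![0, v; v, 0] - S).det := by
      intro v
      have : Matrix.scalar (BookVertex m) t - bookMatrix m a b v =
          Matrix.fromBlocks (Matrix.scalar (Fin 2) t - !![0, v; v, 0]) (-bookRows m a)
            (-(bookRows m b)ᵀ) ((1 : Matrix (Fin m) (Fin m) ℂ) ⊗ₖ Q) := by
        rw [bookMatrix]
        ext (x | ⟨j, i⟩) (y | ⟨j', i'⟩)
        · simp [Matrix.diagonal_apply]
        · simp
        · simp
        · by_cases hj : j = j' <;> by_cases hi : i = i' <;>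
            simp [hQ, hi, hj]
      rw [Matrix.eval_charpoly, this, Matrix.det_fromBlocks₂₂, invOf_eq_right_inv hD, hS]
      simp
    have h01 : S 0 1 = 0 := by
      refine (mul_one_kronecker_mul_apply ![a, 1] _ ![b, 1] _ _ 0 1).trans ?_
      simp [ha]
    have h10 : S 1 0 = 0 := by
      refine (mul_one_kronecker_mul_apply ![a, 1] _ ![b, 1] _ _ 1 0).trans ?_
      simp [hb]
    change Polynomial.eval _ _ = Polynomial.eval _ _
    rw [hdet, hdet, Matrix.det_fin_two, Matrix.det_fin_two]
    simp [h01, h10]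
  · exact (Polynomial.finite_setOfPred_isRoot (Matrix.charpoly_monic _).ne_zero).infinite_compl

/-! ### The arcs of the book graph -/

theorem inl_eq_bookXPath {m : ℕ} {j s : Fin m} {a : Fin 2} :
    Sum.inl a = bookXPath m j s ↔ s.val = 0 ∧ a = 0 := by
  unfold bookXPath bookX
  split_ifs with h <;> simp [h]

theorem inr_eq_bookXPath {m : ℕ} {j s : Fin m} {p : Fin m × Fin (2 * m - 3)} :
    Sum.inr p = bookXPath m j s ↔ p.1 = j ∧ 0 < s.val ∧ p.2.val + s.val = 2 * m - 3 := by
  obtain ⟨j', i⟩ := p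
  unfold bookXPath bookX
  split_ifs with h
  · simp [h]
  · simp only [Sum.inr.injEq, Prod.mk.injEq, Fin.ext_iff]
    omega

theorem inl_eq_bookYPath {m : ℕ} {j s : Fin m} {a : Fin 2} :
    Sum.inl a = bookYPath m j s ↔ s.val = 0 ∧ a = 1 := by
  unfold bookYPath bookY
  split_ifs with h <;> simp [h]

theorem inr_eq_bookYPath {m : ℕ} {j s : Fin m} {p : Fin m × Fin (2 * m - 3)} :
    Sum.inr p = bookYPath m j s ↔ p.1 = j ∧ p.2.val + 1 = s.val := by
  obtain ⟨j', i⟩ := p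
  unfold bookYPath bookY
  split_ifs with h
  · simp [h]
  · simp only [Sum.inr.injEq, Prod.mk.injEq, Fin.ext_iff]
    omega

theorem bookGraph_arc_inl_inl {m : ℕ} {a b : Fin 2} :
    (bookGraph m).Arc (Sum.inl a) (Sum.inl b) ↔ a = 0 ∧ b = 1 := by
  simp only [bookGraph, orientedPath, inl_eq_bookXPath, inl_eq_bookYPath, bookX, bookY,
    Sum.inl.injEq]
  constructor
  · rintro (h | ⟨j, s, t, h, h1, h2⟩ | ⟨j, s, t, h, h1, h2⟩)
    · exact h
    all_goals omega
  · exact Or.inl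

theorem bookGraph_arc_inl_inr {m : ℕ} {a : Fin 2} {j : Fin m} {i : Fin (2 * m - 3)} :
    (bookGraph m).Arc (Sum.inl a) (Sum.inr (j, i)) ↔ a = 1 ∧ i.val = 0 ∧ 0 < j.val := by
  simp only [bookGraph, orientedPath, inl_eq_bookXPath, inl_eq_bookYPath, inr_eq_bookXPath,
    inr_eq_bookYPath, bookX, bookY, reduceCtorEq, and_false, false_or]
  constructor
  · rintro (⟨j, s, t, h, h1, h2⟩ | ⟨j', s, t, h, h1, rfl, h2⟩)
    all_goals omega
  · rintro ⟨h1, h2, h3⟩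
    exact Or.inr ⟨j, ⟨0, by omega⟩, ⟨1, by omega⟩, Or.inl ⟨rfl, h3⟩, ⟨rfl, h1⟩, rfl, by simp [h2]⟩

theorem bookGraph_arc_inr_inl {m : ℕ} {a : Fin 2} {j : Fin m} {i : Fin (2 * m - 3)} :
    (bookGraph m).Arc (Sum.inr (j, i)) (Sum.inl a) ↔
      (a = 0 ∧ i.val + 1 = 2 * m - 3) ∨ (a = 1 ∧ i.val = 0 ∧ j.val = 0) := by
  simp only [bookGraph, orientedPath, inl_eq_bookXPath, inl_eq_bookYPath, inr_eq_bookXPath,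
    inr_eq_bookYPath, bookX, bookY, reduceCtorEq, false_and, false_or]
  constructor
  · rintro (⟨j, s, t, h, h1, h2⟩ | ⟨j', s, t, h, ⟨rfl, h1⟩, h2⟩)
    · exact Or.inl ⟨h2.2, by omega⟩
    · exact Or.inr ⟨h2.2, by omega, by omega⟩
  · rintro (⟨h1, h2⟩ | ⟨h1, h2, h3⟩)
    · exact Or.inl ⟨j, ⟨1, by omega⟩, ⟨0, by omega⟩, Or.inr ⟨rfl, Nat.zero_le _⟩,
        ⟨rfl, Nat.one_pos, h2⟩, rfl, h1⟩
    · exact Or.inr ⟨j, ⟨1, by omega⟩, ⟨0, by omega⟩, Or.inr ⟨rfl, h3.le⟩,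
        ⟨rfl, by simp [h2]⟩, rfl, h1⟩

theorem bookGraph_arc_inr_inr {m : ℕ} {j j' : Fin m} {i i' : Fin (2 * m - 3)} :
    (bookGraph m).Arc (Sum.inr (j, i)) (Sum.inr (j', i')) ↔ j = j' ∧
      ((i.val + 1 = i'.val ∧ (i.val + 1 < j.val ∨ m ≤ i.val + 2)) ∨
        (i'.val + 1 = i.val ∧ j.val ≤ i'.val + 1 ∧ i'.val + 2 < m)) := by
  simp only [bookGraph, orientedPath, inr_eq_bookXPath, inr_eq_bookYPath, bookX, bookY,
    reduceCtorEq, false_and, false_or]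
  constructor
  · rintro (⟨j'', s, t, h, ⟨rfl, h1⟩, h2⟩ | ⟨j'', s, t, h, ⟨rfl, h1⟩, h2⟩)
    · exact ⟨h2.1.symm, by omega⟩
    · exact ⟨h2.1.symm, by omega⟩
  · rintro ⟨rfl, ⟨h1, h2 | h2⟩ | ⟨h1, h2, h3⟩⟩
    · exact Or.inr ⟨j, ⟨i.val + 1, by omega⟩, ⟨i'.val + 1, by omega⟩,
        Or.inl ⟨by simpa using h1, by simpa using h2⟩, ⟨rfl, rfl⟩, rfl, rfl⟩
    · exact Or.inl ⟨j, ⟨2 * m - 3 - i.val, by omega⟩, ⟨2 * m - 3 - i'.val, by omega⟩,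
        Or.inr ⟨by simp; omega, Nat.zero_le _⟩, ⟨rfl, by simp⟩, rfl, by simp⟩
    · exact Or.inr ⟨j, ⟨i.val + 1, by omega⟩, ⟨i'.val + 1, by omega⟩,
        Or.inr ⟨by simpa using h1, by simpa using h2⟩, ⟨rfl, rfl⟩, rfl, rfl⟩

theorem bookGraph_isOriented (m : ℕ) : (bookGraph m).IsOriented := by
  rintro (a | ⟨j, i⟩) (b | ⟨j', i'⟩) h h' <;>
    simp only [bookGraph_arc_inl_inl, bookGraph_arc_inl_inr, bookGraph_arc_inr_inl,
      bookGraph_arc_inr_inr] at h h'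
  · omega
  · omega
  · omega
  · obtain ⟨rfl, h⟩ := h
    omega

/-! ### The cycles of the book graph -/

/-- The cycle through the page `j`: it starts with the edge from `x` to `y` and returns to `x`
along the page. -/
def bookCycle (m : ℕ) (j : Fin m) (k : Fin (2 * m - 1)) : BookVertex m :=
  if h0 : k.val = 0 then bookX m
  else if h1 : k.val = 1 then bookY m
  else Sum.inr (j, ⟨k.val - 2, by omega⟩)

/-- The flux, in units of `θ`, of the first `k` steps of `bookCycle` in the page `j`: it increases
along the edge `xy` and the first `j` edges of the path from `y`, decreases until the middle vertex
is reached after `m` steps, and increases again on the way to `x`. -/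
def bookPotential (m j k : ℕ) : ℤ :=
  if k ≤ j + 1 then k else if k ≤ m then 2 * (j + 1) - k else 2 * (j + 1) - 2 * m + k

theorem bookPotential_succ_of_forward {m j k : ℕ} (hj : j < m) (h : k ≤ j ∨ m ≤ k) :
    bookPotential m j (k + 1) = bookPotential m j k + 1 := by
  unfold bookPotential
  split_ifs <;> omega

theorem bookPotential_succ_of_backward {m j k : ℕ} (hj : j < k) (hk : k < m) :
    bookPotential m j (k + 1) = bookPotential m j k - 1 := by
  unfold bookPotential
  split_ifs <;> omega

theorem bookPotential_end {m j : ℕ} (hm : 2 ≤ m) (hj : j < m) :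
    bookPotential m j (2 * m - 1) = 2 * j + 1 := by
  unfold bookPotential
  split_ifs <;> omega

namespace MixedGraph

theorem form_of_arc {V : Type*} {G : MixedGraph V} (hG : G.IsOriented) (θ : ℝ) {x y : V}
    (h : G.Arc x y) : G.form θ x y = θ := by
  simp [form, h, hG x y h]

theorem form_of_arc_symm {V : Type*} {G : MixedGraph V} (hG : G.IsOriented) (θ : ℝ) {x y : V}
    (h : G.Arc y x) : G.form θ x y = -θ := by
  simp [form, h, hG y x h]

theorem hermAdj_of_arc {V : Type*} {G : MixedGraph V} (hG : G.IsOriented) (θ : ℝ) {x y : V}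
    (h : G.Arc x y) : G.hermAdj θ x y = Complex.exp (Complex.I * θ) := by
  simp [hermAdj, h, hG x y h]

theorem hermAdj_of_arc_symm {V : Type*} {G : MixedGraph V} (hG : G.IsOriented) (θ : ℝ) {x y : V}
    (h : G.Arc y x) : G.hermAdj θ x y = (Complex.exp (Complex.I * θ))⁻¹ := by
  simp [hermAdj, h, hG y x h, Complex.exp_neg]

theorem hermAdj_of_not_arc {V : Type*} {G : MixedGraph V} (θ : ℝ) {x y : V}
    (h : ¬ G.Arc x y) (h' : ¬ G.Arc y x) : G.hermAdj θ x y = 0 := by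
  simp [hermAdj, h, h']

end MixedGraph

theorem finRotate_val {n : ℕ} (k : Fin n) : (finRotate n k).val = (k.val + 1) % n := by
  cases n with
  | zero => exact k.elim0
  | succ n => rw [finRotate_apply, Fin.val_add, Fin.val_one', Nat.add_mod_mod]

theorem bookCycle_injective (m : ℕ) (j : Fin m) : Function.Injective (bookCycle m j) := by
  intro k k' h
  unfold bookCycle bookX bookY at h
  split_ifs at h <;> simp at h <;> omega

/-- The step of `bookCycle` from `k` to `k + 1` goes along an arc if it precedes the first backward
step of the path from `y`, or follows the middle vertex. -/
theorem bookCycle_arc {m : ℕ} (hm : 2 ≤ m) {j : Fin m} {k k' : Fin (2 * m - 1)}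
    (h : k'.val = (k.val + 1) % (2 * m - 1)) (hk : k.val ≤ j.val ∨ m ≤ k.val) :
    (bookGraph m).Arc (bookCycle m j k) (bookCycle m j k') := by
  have hlt := k.isLt
  rcases eq_or_ne (k.val + 1) (2 * m - 1) with e | e
  · rw [e, Nat.mod_self] at h
    rw [bookCycle, bookCycle, dif_neg (by omega), dif_neg (by omega), dif_pos h, bookX,
      bookGraph_arc_inr_inl]
    exact Or.inl ⟨rfl, by simp; omega⟩
  · rw [Nat.mod_eq_of_lt (by omega)] at h
    unfold bookCycle bookX bookY
    split_ifs <;> simp only [bookGraph_arc_inl_inl, bookGraph_arc_inl_inr, bookGraph_arc_inr_inl,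
      bookGraph_arc_inr_inr, true_and] <;> omega

theorem bookCycle_arc_symm {m : ℕ} {j : Fin m} {k k' : Fin (2 * m - 1)}
    (h : k'.val = (k.val + 1) % (2 * m - 1)) (hk : j.val < k.val) (hk' : k.val < m) :
    (bookGraph m).Arc (bookCycle m j k') (bookCycle m j k) := by
  have hlt := k.isLt
  rw [Nat.mod_eq_of_lt (by omega)] at h
  unfold bookCycle bookX bookY
  split_ifs <;> simp only [bookGraph_arc_inl_inl, bookGraph_arc_inl_inr, bookGraph_arc_inr_inl,
      bookGraph_arc_inr_inr, true_and] <;> omega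

theorem bookCycle_adj {m : ℕ} (hm : 2 ≤ m) {j : Fin m} {k k' : Fin (2 * m - 1)}
    (h : k'.val = (k.val + 1) % (2 * m - 1)) :
    (bookGraph m).underlying.Adj (bookCycle m j k) (bookCycle m j k') := by
  by_cases hk : k.val ≤ j.val ∨ m ≤ k.val
  · exact Or.inl (bookCycle_arc hm h hk)
  · exact Or.inr (bookCycle_arc_symm h (by omega) (by omega))

theorem cycleGraph_adj_iff_mod {n : ℕ} (hn : 2 ≤ n) {u v : Fin n} :
    (SimpleGraph.cycleGraph n).Adj u v ↔
      v.val = (u.val + 1) % n ∨ u.val = (v.val + 1) % n := by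
  rw [SimpleGraph.cycleGraph_adj', Fin.sub_def, Fin.sub_def]
  have h (a b : Fin n) : (n - b.val + a.val) % n = 1 ↔ a.val = (b.val + 1) % n := by
    have ha := a.isLt
    have hb := b.isLt
    rcases lt_or_ge a.val b.val with hab | hab
    · rw [Nat.mod_eq_of_lt (by omega)]
      rcases eq_or_ne (b.val + 1) n with e | e
      · rw [e, Nat.mod_self]; omega
      · rw [Nat.mod_eq_of_lt (by omega)]; omega
    · rw [show n - b.val + a.val = (a.val - b.val) + n by omega, Nat.add_mod_right,
        Nat.mod_eq_of_lt (by omega)]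
      rcases eq_or_ne (b.val + 1) n with e | e
      · rw [e, Nat.mod_self]; omega
      · rw [Nat.mod_eq_of_lt (by omega)]; omega
  simp only [h]
  exact or_comm

/-- `bookCycle` as a copy of the cycle on `2 * m - 1` vertices in the underlying graph. -/
def bookCycleCopy (m : ℕ) (hm : 2 ≤ m) (j : Fin m) :
    (SimpleGraph.cycleGraph (2 * m - 1)).Copy (bookGraph m).underlying where
  toHom := ⟨bookCycle m j, fun {u v} h => by
    rcases (cycleGraph_adj_iff_mod (by omega)).1 h with h | h
    · exact bookCycle_adj hm h
    · exact (bookCycle_adj hm h).symm⟩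
  injective' := bookCycle_injective m j

theorem coe_bookCycleCopy (m : ℕ) (hm : 2 ≤ m) (j : Fin m) :
    ⇑(bookCycleCopy m hm j) = bookCycle m j := rfl

theorem inl_mem_range_bookCycle {m : ℕ} (hm : 2 ≤ m) (j : Fin m) (a : Fin 2) :
    Sum.inl a ∈ Set.range (bookCycle m j) := by
  refine ⟨⟨a.val, by omega⟩, ?_⟩
  fin_cases a <;> simp [bookCycle, bookX, bookY]

theorem inr_mem_range_bookCycle {m : ℕ} (j j' : Fin m) (i : Fin (2 * m - 3)) :
    Sum.inr (j', i) ∈ Set.range (bookCycle m j) ↔ j' = j := by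
  constructor
  · rintro ⟨k, hk⟩
    unfold bookCycle bookX bookY at hk
    split_ifs at hk
    simp only [Sum.inr.injEq, Prod.mk.injEq] at hk
    exact hk.1.symm
  · rintro rfl
    exact ⟨⟨i.val + 2, by omega⟩, by simp [bookCycle]⟩

theorem mem_range_bookCycle {m : ℕ} (hm : 2 ≤ m) (j : Fin m) (v : BookVertex m) :
    v ∈ Set.range (bookCycle m j) ↔ v = bookX m ∨ v = bookY m ∨ ∃ i, v = Sum.inr (j, i) := by
  rcases v with a | ⟨j', i⟩
  · simp only [inl_mem_range_bookCycle hm, true_iff]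
    fin_cases a <;> simp [bookX, bookY]
  · rw [inr_mem_range_bookCycle]
    simp [bookX, bookY]

theorem exists_bookCycle_of_arc {m : ℕ} (hm : 2 ≤ m) {u v : BookVertex m}
    (h : (bookGraph m).Arc u v) :
    ∃ j a b, (SimpleGraph.cycleGraph (2 * m - 1)).Adj a b ∧ bookCycle m j a = u ∧
      bookCycle m j b = v := by
  have hn : 2 ≤ 2 * m - 1 := by omega
  have hsucc (k : ℕ) (hk : k + 1 < 2 * m - 1) : (SimpleGraph.cycleGraph (2 * m - 1)).Adj
      ⟨k, by omega⟩ ⟨k + 1, hk⟩ :=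
    (cycleGraph_adj_iff_mod hn).2 (Or.inl (Nat.mod_eq_of_lt hk).symm)
  have hlast : (SimpleGraph.cycleGraph (2 * m - 1)).Adj ⟨2 * m - 2, by omega⟩ ⟨0, by omega⟩ :=
    (cycleGraph_adj_iff_mod hn).2 (Or.inl (by
      simp only [show 2 * m - 2 + 1 = 2 * m - 1 by omega, Nat.mod_self]))
  rcases u with a | ⟨j, i⟩ <;> rcases v with b | ⟨j', i'⟩
  · obtain ⟨rfl, rfl⟩ := bookGraph_arc_inl_inl.1 h
    exact ⟨⟨0, by omega⟩, _, _, hsucc 0 (by omega), by simp [bookCycle, bookX],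
      by simp [bookCycle, bookY]⟩
  · obtain ⟨rfl, h, -⟩ := bookGraph_arc_inl_inr.1 h
    exact ⟨j', _, _, hsucc 1 (by omega), by simp [bookCycle, bookY],
      by simp [bookCycle, Fin.ext_iff, h]⟩
  · rcases bookGraph_arc_inr_inl.1 h with ⟨rfl, h⟩ | ⟨rfl, h, -⟩
    · refine ⟨j, _, _, hlast, ?_, by simp [bookCycle, bookX]⟩
      rw [bookCycle, dif_neg (by simp; omega), dif_neg (by simp; omega)]
      simp [Fin.ext_iff]
      omega
    · exact ⟨j, _, _, (hsucc 1 (by omega)).symm, by simp [bookCycle, Fin.ext_iff, h],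
        by simp [bookCycle, bookY]⟩
  · obtain ⟨rfl, ⟨h, -⟩ | ⟨h, -⟩⟩ := bookGraph_arc_inr_inr.1 h
    · exact ⟨j, _, _, hsucc (i.val + 2) (by omega), by simp [bookCycle],
        by simp [bookCycle, Fin.ext_iff]; omega⟩
    · exact ⟨j, _, _, (hsucc (i'.val + 2) (by omega)).symm,
        by simp [bookCycle, Fin.ext_iff]; omega, by simp [bookCycle]⟩

theorem isBook_bookCycleCopy (m : ℕ) (hm : 2 ≤ m) :
    IsBook (bookGraph m).underlying (bookX m) (bookY m) (bookCycleCopy m hm) := by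
  simp only [IsBook, coe_bookCycleCopy]
  refine ⟨fun j k => ⟨fun h => ?_, fun h => ?_⟩, fun i j hij => ?_, fun v => ?_, fun u v h => ?_⟩
  · simp [bookCycle, h]
  · simp [bookCycle, h]
  · ext v
    simp only [Set.mem_inter_iff, mem_range_bookCycle hm, Set.mem_insert_iff,
      Set.mem_singleton_iff]
    constructor
    · rintro ⟨h | h | ⟨a, h⟩, h' | h' | ⟨b, h'⟩⟩
      all_goals first | exact Or.inl ‹v = bookX m› | exact Or.inr ‹v = bookY m› | skip
      rw [h, Sum.inr.injEq, Prod.mk.injEq] at h'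
      exact absurd h'.1 hij
    · tauto
  · rcases v with a | ⟨j, i⟩
    · exact ⟨⟨0, by omega⟩, inl_mem_range_bookCycle hm _ a⟩
    · exact ⟨j, (inr_mem_range_bookCycle _ _ _).2 rfl⟩
  · rcases h with h | h
    · exact exists_bookCycle_of_arc hm h
    · obtain ⟨j, a, b, hab, h1, h2⟩ := exists_bookCycle_of_arc hm h
      exact ⟨j, b, a, hab.symm, h2, h1⟩

theorem bookPath_mem_range_bookCycle {m : ℕ} (hm : 2 ≤ m) (j s : Fin m) :
    bookXPath m j s ∈ Set.range (bookCycle m j) ∧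
      bookYPath m j s ∈ Set.range (bookCycle m j) := by
  unfold bookXPath bookYPath
  split_ifs with h
  · exact ⟨inl_mem_range_bookCycle hm j 0, inl_mem_range_bookCycle hm j 1⟩
  · exact ⟨(inr_mem_range_bookCycle _ _ _).2 rfl, (inr_mem_range_bookCycle _ _ _).2 rfl⟩

theorem flux_bookCycle {m : ℕ} (hm : 2 ≤ m) (θ : ℝ) (j : Fin m) :
    (bookGraph m).flux θ (bookCycle m j) = (2 * ((j.val : ℝ) + 1) - 1) * θ := by
  have hO := bookGraph_isOriented m
  have hstep (k : Fin (2 * m - 1)) :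
      (bookGraph m).form θ (bookCycle m j k) (bookCycle m j (finRotate _ k)) =
        ((bookPotential m j (k.val + 1) : ℝ) - bookPotential m j k.val) * θ := by
    by_cases hk : k.val ≤ j.val ∨ m ≤ k.val
    · rw [MixedGraph.form_of_arc hO θ (bookCycle_arc hm (finRotate_val k) hk),
        bookPotential_succ_of_forward j.isLt hk]
      push_cast
      ring
    · rw [MixedGraph.form_of_arc_symm hO θ
          (bookCycle_arc_symm (finRotate_val k) (by omega) (by omega)),
        bookPotential_succ_of_backward (by omega) (by omega)]
      push_cast
      ring
  unfold MixedGraph.flux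
  rw [Finset.sum_congr rfl fun k _ => hstep k, ← Finset.sum_mul,
    Fin.sum_univ_eq_sum_range
      (fun k => (bookPotential m j (k + 1) : ℝ) - bookPotential m j k) (2 * m - 1),
    Finset.sum_range_sub (fun k => (bookPotential m j k : ℝ)), bookPotential_end hm j.isLt]
  simp [bookPotential]
  left
  ring

theorem not_isBipartite_bookGraph {m : ℕ} (hm : 2 ≤ m) : ¬ (bookGraph m).IsBipartite := by
  intro h
  have hc : (SimpleGraph.cycleGraph (2 * m - 1)).Colorable 2 :=
    SimpleGraph.Colorable.of_hom (bookCycleCopy m hm ⟨0, by omega⟩).toHom h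
  have h3 := SimpleGraph.chromaticNumber_cycleGraph_of_odd (2 * m - 1) (by omega)
    ⟨m - 1, by omega⟩
  have := hc.chromaticNumber_le
  rw [h3] at this
  exact absurd this (by decide)

/-! ### The spectrum of the book graph -/

/-- The diagonal gauge transformation by the phases accumulated along the pages. The value at the
vertex `i` of a page has the index `i + 2`, its position in `bookCycle`. -/
noncomputable def bookGauge (m : ℕ) (z : ℂ) : BookVertex m → ℂ :=
  Sum.elim ![1, z] fun p => z ^ bookPotential m p.1.val (p.2.val + 2)

/-- The gauge transformation `bookGauge` removes the phases of all edges but those from the pages to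
`x`, where the flux `2 j + 1` of the closed cycle `bookCycle` remains. -/
theorem charpoly_hermAdj_bookGraph {m : ℕ} (hm : 2 ≤ m) (θ : ℝ) :
    ((bookGraph m).hermAdj θ).charpoly =
      (bookMatrix m (fun j => (Complex.exp (Complex.I * θ))⁻¹ ^ (2 * j.val + 1))
        (fun j => Complex.exp (Complex.I * θ) ^ (2 * j.val + 1)) 1).charpoly := by
  have hz : Complex.exp (Complex.I * θ) ≠ 0 := Complex.exp_ne_zero _
  have hO := bookGraph_isOriented m
  have harc (u v) (h : (bookGraph m).Arc u v) := MixedGraph.hermAdj_of_arc hO θ h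
  have hsymm (u v) (h : (bookGraph m).Arc v u) := MixedGraph.hermAdj_of_arc_symm hO θ h
  have hnot (u v) (h : ¬ ((bookGraph m).Arc u v ∨ (bookGraph m).Arc v u)) :=
    MixedGraph.hermAdj_of_not_arc θ (not_or.1 h).1 (not_or.1 h).2
  set z := Complex.exp (Complex.I * θ)
  have hpos (j : Fin m) (k : ℕ) (h : k ≤ j.val ∨ m ≤ k) :
      z ^ bookPotential m j.val (k + 1) = z ^ bookPotential m j.val k * z := by
    rw [bookPotential_succ_of_forward j.isLt h, zpow_add_one₀ hz]
  have hneg (j : Fin m) (k : ℕ) (h : ¬ (k ≤ j.val ∨ m ≤ k)) :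
      z ^ bookPotential m j.val (k + 1) = z ^ bookPotential m j.val k * z⁻¹ := by
    rw [bookPotential_succ_of_backward (by omega) (by omega), zpow_sub_one₀ hz]
  have hone (j : Fin m) : z ^ bookPotential m j.val 1 = z := by simp [bookPotential]
  have hlast (j : Fin m) (i : Fin (2 * m - 3)) (h : i.val + 1 = 2 * m - 3) :
      z ^ bookPotential m j.val (i.val + 2) * z = z ^ (2 * j.val + 1) := by
    rw [← hpos j _ (by omega), show i.val + 2 + 1 = 2 * m - 1 by omega,
      bookPotential_end hm j.isLt]
    norm_cast
  refine charpoly_eq_of_gauge (u := bookGauge m z) ?_ ?_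
  · rintro (a | p)
    · fin_cases a <;> simp [bookGauge, hz]
    · exact zpow_ne_zero _ hz
  · rintro (a | ⟨j, i⟩) (b | ⟨j', i'⟩)
    · fin_cases a <;> fin_cases b
      · rw [hnot _ _ (by simp [bookGraph_arc_inl_inl])]
        simp [bookMatrix]
      · rw [harc _ _ (by simp [bookGraph_arc_inl_inl])]
        simp [bookMatrix, bookGauge]
      · rw [hsymm _ _ (by simp [bookGraph_arc_inl_inl])]
        simp [bookMatrix, bookGauge, hz]
      · rw [hnot _ _ (by simp [bookGraph_arc_inl_inl])]
        simp [bookMatrix]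
    · obtain rfl | rfl : a = 0 ∨ a = 1 := by omega
      · by_cases h : i'.val + 1 = 2 * m - 3
        · rw [hsymm _ _ (bookGraph_arc_inr_inl.2 (Or.inl ⟨rfl, h⟩))]
          simp [bookMatrix, bookRows, pathEnd, bookGauge, h, ← hlast j' i' h]
          rw [mul_assoc, inv_mul_cancel₀ (zpow_ne_zero _ hz), mul_one]
        · rw [hnot _ _ (by simp [bookGraph_arc_inl_inr, bookGraph_arc_inr_inl, h])]
          simp [bookMatrix, bookRows, pathEnd, h]
      · by_cases h : i'.val = 0
        · by_cases hj : 0 < j'.val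
          · rw [harc _ _ (bookGraph_arc_inl_inr.2 ⟨rfl, h, hj⟩)]
            simp [bookMatrix, bookRows, pathEnd, bookGauge, h, hpos j' 1 (Or.inl hj), hone]
          · rw [hsymm _ _ (bookGraph_arc_inr_inl.2 (Or.inr ⟨rfl, h, by omega⟩))]
            simp [bookMatrix, bookRows, pathEnd, bookGauge, h, hneg j' 1 (by omega), hone]
        · rw [hnot _ _ (by simp [bookGraph_arc_inl_inr, bookGraph_arc_inr_inl, h])]
          simp [bookMatrix, bookRows, pathEnd, h]
    · obtain rfl | rfl : b = 0 ∨ b = 1 := by omega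
      · by_cases h : i.val + 1 = 2 * m - 3
        · rw [harc _ _ (bookGraph_arc_inr_inl.2 (Or.inl ⟨rfl, h⟩))]
          simp [bookMatrix, bookRows, pathEnd, bookGauge, h, hlast j i h]
        · rw [hnot _ _ (by simp [bookGraph_arc_inl_inr, bookGraph_arc_inr_inl, h])]
          simp [bookMatrix, bookRows, pathEnd, h]
      · by_cases h : i.val = 0
        · by_cases hj : 0 < j.val
          · rw [hsymm _ _ (bookGraph_arc_inl_inr.2 ⟨rfl, h, hj⟩)]
            simp [bookMatrix, bookRows, pathEnd, bookGauge, h, hpos j 1 (Or.inl hj), hone, hz]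
          · rw [harc _ _ (bookGraph_arc_inr_inl.2 (Or.inr ⟨rfl, h, by omega⟩))]
            simp [bookMatrix, bookRows, pathEnd, bookGauge, h, hneg j 1 (by omega), hone, hz]
        · rw [hnot _ _ (by simp [bookGraph_arc_inl_inr, bookGraph_arc_inr_inl, h])]
          simp [bookMatrix, bookRows, pathEnd, h]
    · have hK : bookMatrix m (fun j => z⁻¹ ^ (2 * j.val + 1)) (fun j => z ^ (2 * j.val + 1)) 1
          (Sum.inr (j, i)) (Sum.inr (j', i')) =
          if i.val + 1 = i'.val ∨ i'.val + 1 = i.val then if j = j' then 1 else 0 else 0 := by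
        simp [bookMatrix, Matrix.one_apply, pathMatrix]
      rw [hK]
      split_ifs with h hj
      · subst hj
        simp only [bookGauge, Sum.elim_inr, one_mul]
        rcases h with h | h
        · rw [← h, show i.val + 1 + 2 = i.val + 2 + 1 by omega]
          by_cases hk : i.val + 2 ≤ j.val ∨ m ≤ i.val + 2
          · rw [harc _ _ (bookGraph_arc_inr_inr.2 ⟨rfl, Or.inl ⟨h, by omega⟩⟩), hpos j _ hk]
          · rw [hsymm _ _ (bookGraph_arc_inr_inr.2 ⟨rfl, Or.inr ⟨h, by omega, by omega⟩⟩),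
              hneg j _ hk]
        · rw [← h, show i'.val + 1 + 2 = i'.val + 2 + 1 by omega]
          by_cases hk : i'.val + 2 ≤ j.val ∨ m ≤ i'.val + 2
          · rw [hsymm _ _ (bookGraph_arc_inr_inr.2 ⟨rfl, Or.inl ⟨h, by omega⟩⟩), hpos j _ hk,
              mul_inv_cancel_right₀ hz]
          · rw [harc _ _ (bookGraph_arc_inr_inr.2 ⟨rfl, Or.inr ⟨h, by omega, by omega⟩⟩),
              hneg j _ hk, inv_mul_cancel_right₀ hz]
      · rw [hnot _ _ (by simp only [bookGraph_arc_inr_inr]; omega), mul_zero, zero_mul]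
      · rw [hnot _ _ (by simp only [bookGraph_arc_inr_inr]; omega), mul_zero, zero_mul]

/-- Without the edge `xy` a book with pages of odd length is bipartite, so that negating its matrix
amounts to changing the sign of the entry for `xy`. -/
theorem charpoly_neg_bookMatrix {m : ℕ} (hm : 2 ≤ m) (a b : Fin m → ℂ) (w : ℂ) :
    (-bookMatrix m a b w).charpoly = (bookMatrix m a b (-w)).charpoly := by
  refine charpoly_eq_of_gauge (u := Sum.elim (fun _ => 1) fun p => (-1) ^ (p.2.val + 1)) ?_ ?_
  · rintro (r | p)
    · exact one_ne_zero
    · exact pow_ne_zero _ (by norm_num)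
  · have hlast : (-1 : ℂ) ^ (2 * m - 3) = -1 :=
      Odd.neg_one_pow ⟨m - 2, by omega⟩
    rintro (r | ⟨j, i⟩) (s | ⟨j', i'⟩)
    · fin_cases r <;> fin_cases s <;> simp [bookMatrix]
    · fin_cases r
      · by_cases h : i'.val + 1 = 2 * m - 3
        · simp [bookMatrix, bookRows, pathEnd, h, hlast]
        · simp [bookMatrix, bookRows, pathEnd, h]
      · by_cases h : i'.val = 0 <;> simp [bookMatrix, bookRows, pathEnd, h]
    · fin_cases s
      · by_cases h : i.val + 1 = 2 * m - 3
        · simp [bookMatrix, bookRows, pathEnd, h, hlast]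
        · simp [bookMatrix, bookRows, pathEnd, h]
      · by_cases h : i.val = 0 <;> simp [bookMatrix, bookRows, pathEnd, h]
    · by_cases h : i.val + 1 = i'.val ∨ i'.val + 1 = i.val
      · simp only [Sum.elim_inr, bookMatrix, Matrix.neg_apply, Matrix.fromBlocks_apply₂₂,
          Matrix.kronecker_apply, pathMatrix, Matrix.of_apply, if_pos h]
        rcases h with h | h <;> rw [← h] <;> ring
      · simp [bookMatrix, pathMatrix, h]

/-- The fluxes of the cycles of the book graph cancel. -/
theorem sum_odd_pow_eq_zero {K : Type*} [Field K] {m : ℕ} {z : K} (h : z ^ (2 * m) = 1)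
    (h1 : z ^ 2 ≠ 1) : ∑ j : Fin m, z ^ (2 * j.val + 1) = 0 := by
  simp only [pow_succ z (2 * _), pow_mul]
  rw [← Finset.sum_mul, Fin.sum_univ_eq_sum_range (fun j => (z ^ 2) ^ j), geom_sum_eq h1, ← pow_mul,
    h, sub_self, zero_div, zero_mul]

theorem charpoly_neg_hermAdj_bookGraph {l m : ℕ} {θ : ℝ} (hl : 0 < l) (hlm : l < m)
    (hθ : θ = (l : ℝ) / (m : ℝ) * Real.pi) :
    (-(bookGraph m).hermAdj θ).charpoly = ((bookGraph m).hermAdj θ).charpoly := by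
  have hm : 2 ≤ m := by omega
  have hm0 : (m : ℂ) ≠ 0 := by exact_mod_cast (by omega : m ≠ 0)
  have hπ : (Real.pi : ℂ) ≠ 0 := by exact_mod_cast Real.pi_ne_zero
  have h1 : Complex.exp (Complex.I * θ) ^ (2 * m) = 1 := by
    rw [← Complex.exp_nat_mul, Complex.exp_eq_one_iff]
    refine ⟨l, ?_⟩
    rw [hθ]
    push_cast
    field_simp
  have h2 : Complex.exp (Complex.I * θ) ^ 2 ≠ 1 := by
    rw [← Complex.exp_nat_mul, Ne, Complex.exp_eq_one_iff]
    rintro ⟨n, hn⟩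
    rw [hθ] at hn
    push_cast at hn
    have hn' : (l : ℂ) = n * m := by
      field_simp at hn
      linear_combination hn
    have hn2 : (l : ℤ) = n * m := by exact_mod_cast hn'
    rcases lt_or_ge 0 n with h | h <;> nlinarith
  have key := charpoly_bookMatrix_neg 
    (a := fun j => (Complex.exp (Complex.I * θ))⁻¹ ^ (2 * j.val + 1))
    (sum_odd_pow_eq_zero (by rw [inv_pow, h1, inv_one])
      (by rwa [inv_pow, Ne, inv_eq_one])) (sum_odd_pow_eq_zero h1 h2) 1
  rw [charpoly_neg, charpoly_hermAdj_bookGraph hm θ, ← charpoly_neg, charpoly_neg_bookMatrix hm]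
  exact key

/-! ### The four-vertex graph -/

theorem hermAdj_fourVertexGraph :
    fourVertexGraph.hermAdj Real.pi = !![0, -1, 1, 1; -1, 0, 1, 0; 1, 1, 0, 1; 1, 0, 1, 0] := by
  have h : Complex.exp (Complex.I * Real.pi) = -1 := by
    rw [mul_comm, Complex.exp_pi_mul_I]
  ext i j
  fin_cases i <;> fin_cases j <;>
    simp [MixedGraph.hermAdj, fourVertexGraph, h, Complex.exp_neg]

/-- Exchanging the vertices `1` and `3` and changing the sign at the vertex `2` negates the
matrix. -/
theorem charpoly_neg_hermAdj_fourVertexGraph :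
    (-fourVertexGraph.hermAdj Real.pi).charpoly = (fourVertexGraph.hermAdj Real.pi).charpoly := by
  rw [hermAdj_fourVertexGraph]
  refine charpoly_eq_of_intertwine
    (P := !![1, 0, 0, 0; 0, 0, 0, 1; 0, 0, -1, 0; 0, 1, 0, 0]) (IsUnit.of_mul_eq_one
      !![1, 0, 0, 0; 0, 0, 0, 1; 0, 0, -1, 0; 0, 1, 0, 0] ?_) ?_ <;>
  ext i j <;> fin_cases i <;> fin_cases j <;> simp [Matrix.mul_apply, Fin.sum_univ_four]

theorem not_isBipartite_fourVertexGraph : ¬ fourVertexGraph.IsBipartite := by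
  rintro ⟨c⟩
  have h01 : c 0 ≠ c 1 := c.valid (by simp [MixedGraph.underlying, fourVertexGraph])
  have h12 : c 1 ≠ c 2 := c.valid (by simp [MixedGraph.underlying, fourVertexGraph])
  have h02 : c 0 ≠ c 2 := c.valid (by simp [MixedGraph.underlying, fourVertexGraph])
  omega

/-! ### Rational multiples of π -/

theorem not_bipartiteDetectionProperty {θ : ℝ} (h0 : 0 < θ) (hπ : θ ≤ Real.pi)
    (hq : ∃ q : ℚ, θ = q * Real.pi) : ¬ BipartiteDetectionProperty θ := by
  intro h
  obtain ⟨q, hq⟩ := hq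
  rcases hπ.eq_or_lt with rfl | hlt
  · exact not_isBipartite_fourVertexGraph ((h _ _).2
      (MixedGraph.hasSymmetricSpectrum_of_charpoly_neg charpoly_neg_hermAdj_fourVertexGraph))
  · have hq0 : 0 < q := by
      have : (0 : ℝ) < q := pos_of_mul_pos_left (hq ▸ h0) Real.pi_pos.le
      exact_mod_cast this
    have hq1 : q < 1 := by
      have : (q : ℝ) < 1 := by
        by_contra! hge
        nlinarith [Real.pi_pos]
      exact_mod_cast this
    have hnum : 0 < q.num := Rat.num_pos.2 hq0
    have hden : q.num < q.den := Rat.num_lt_denom_iff.2 hq1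
    have hθ : θ = (q.num.toNat : ℝ) / (q.den : ℝ) * Real.pi := by
      rw [hq]
      congr 1
      have : ((q.num.toNat : ℤ) : ℝ) = q.num := by rw [Int.toNat_of_nonneg hnum.le]
      rw [← Int.cast_natCast (R := ℝ) q.num.toNat, this]
      exact Rat.cast_def q
    exact not_isBipartite_bookGraph (m := q.den) (by omega) ((h _ _).2
      (MixedGraph.hasSymmetricSpectrum_of_charpoly_neg
        (charpoly_neg_hermAdj_bookGraph (l := q.num.toNat) (by omega) (by omega) hθ)))

theorem theorem1p2 :
    (∀ θ : ℝ, 0 < θ → θ ≤ Real.pi → (∃ q : ℚ, θ = q * Real.pi) →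
      ¬ BipartiteDetectionProperty θ) ∧
    (¬ fourVertexGraph.IsBipartite ∧ fourVertexGraph.HasSymmetricSpectrum Real.pi) ∧
    (∀ (l m : ℕ) (θ : ℝ), 0 < l → l < m → θ = (l : ℝ) / (m : ℝ) * Real.pi →
      (bookGraph m).IsOriented ∧
      (∃ C : Fin m → (SimpleGraph.cycleGraph (2 * m - 1)).Copy (bookGraph m).underlying,
        IsBook (bookGraph m).underlying (bookX m) (bookY m) C ∧
        ∀ j : Fin m,
          (∀ s, bookXPath m j s ∈ Set.range (C j) ∧ bookYPath m j s ∈ Set.range (C j)) ∧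
          (bookGraph m).flux θ (C j) = (2 * ((j.val : ℝ) + 1) - 1) * θ) ∧
      ¬ (bookGraph m).IsBipartite ∧
      (∀ k : ℕ, Odd k → k ≤ Fintype.card (BookVertex m) →
        ((bookGraph m).hermAdj θ).charpoly.coeff (Fintype.card (BookVertex m) - k) = 0) ∧
      (bookGraph m).HasSymmetricSpectrum θ) := by
  refine ⟨fun θ h0 hπ hq => not_bipartiteDetectionProperty h0 hπ hq,
    ⟨not_isBipartite_fourVertexGraph,
      MixedGraph.hasSymmetricSpectrum_of_charpoly_neg charpoly_neg_hermAdj_fourVertexGraph⟩,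
    fun l m θ hl hlm hθ => ?_⟩
  have hm : 2 ≤ m := by omega
  have hneg := charpoly_neg_hermAdj_bookGraph hl hlm hθ
  exact ⟨bookGraph_isOriented m,
    ⟨bookCycleCopy m hm, isBook_bookCycleCopy m hm,
      fun j => ⟨bookPath_mem_range_bookCycle hm j, flux_bookCycle hm θ j⟩⟩,
    not_isBipartite_bookGraph hm,
    fun k hk hkn => charpoly_coeff_eq_zero_of_neg hneg hk hkn,
    MixedGraph.hasSymmetricSpectrum_of_charpoly_neg hneg⟩
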